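/- For an infinite cardinal $\mu$ and a cardinal $\theta$, write $\theta^{<\mu}=\sup_{\nu<\mu}\theta^{\nu}$; a cardinal $\lambda\ge\mu$ is \emph{almost $\mu$-closed} if $\theta^{<\mu}\le\lambda$ for all $\theta<\lambda$; and $\mathrm{SCH}_{\mu,\ge\theta}$ is the statement that every cardinal $\lambda\ge\theta+\mu$ is almost $\mu$-closed. For an object $M$ of an accessible category $\mathcal K$, the presentability rank $r_{\mathcal K}(M)$ is the least regular cardinal $\kappa$ such that $M$ is $\kappa$-presentable, and the internal size $|M|_{\mathcal K}$ is $\kappa$ if $r_{\mathcal K}(M)=\kappa^+$ is a successor cardinal, and $r_{\mathcal K}(M)$ if it is a limit cardinal. A category is \emph{large} if it is not equivalent to a small category. Let $\mu$ be a regular cardinal and let $\mathcal K$ be a large $\mu$-accessible category all of whose morphisms are monomorphisms. Assume the generalized continuum hypothesis, or just $\mathrm{SCH}_{\mu,\ge\theta}$ for some cardinal $\theta$. Then there is a cardinal $\chi$ such that for every cardinal $\lambda\ge\chi$ with $\operatorname{cf}(\lambda)\ge\mu$ there is an object $M$ of $\mathcal K$ with $|M|_{\mathcal K}=\lambda$.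 -/

import Mathlib

universe w v u

open CategoryTheory Cardinal

/-- The generalized continuum hypothesis. -/
def GCH : Prop :=
  ∀ c : Cardinal.{w}, ℵ₀ ≤ c → (2 : Cardinal.{w}) ^ c = Order.succ c

/-- For infinite cardinals `μ ≤ lam`, the cardinal `lam` is almost `μ`-closed if
`θ ^{<μ} ≤ lam` for all `θ < lam`. -/
def IsAlmostClosed (μ lam : Cardinal.{w}) : Prop :=
  ∀ θ : Cardinal.{w}, θ < lam → θ ^< μ ≤ lam

/-- The hypothesis `SCH_{μ, ≥ θ}`: every cardinal `lam ≥ θ` (with `lam ≥ μ`, as is required for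
almost `μ`-closedness to make sense) is almost `μ`-closed. -/
def SCHAbove (μ θ : Cardinal.{w}) : Prop :=
  ∀ lam : Cardinal.{w}, μ ≤ lam → θ ≤ lam → IsAlmostClosed μ lam

section

variable {C : Type u} [Category.{v} C]

/-- The presentability rank of `M`: the least regular cardinal `κ` such that `M` is
`κ`-presentable. In an accessible category such a cardinal always exists, see
`isLeast_presentabilityRank`. -/
noncomputable def presentabilityRank (M : C) : Cardinal.{w} :=
  sInf {κ : Cardinal.{w} | ∃ _ : Fact κ.IsRegular, IsCardinalPresentable M κ}

theorem isLeast_presentabilityRank [IsAccessibleCategory.{w} C] (M : C) :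
    IsLeast {κ : Cardinal.{w} | ∃ _ : Fact κ.IsRegular, IsCardinalPresentable M κ}
      (presentabilityRank.{w} M) := by
  obtain ⟨κ, hκ, h⟩ := (inferInstance : IsPresentable.{w} M).exists_cardinal
  have hne : {κ : Cardinal.{w} |
      ∃ _ : Fact κ.IsRegular, IsCardinalPresentable M κ}.Nonempty := ⟨κ, hκ, h⟩
  exact ⟨csInf_mem hne, fun _ hx => csInf_le' hx⟩

open Classical in
/-- The internal size of `M`: it is `κ` if the presentability rank of `M` is a successor `κ⁺`,
and the presentability rank itself otherwise. -/
noncomputable def internalSize (M : C) : Cardinal.{w} :=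
  if h : ∃ κ : Cardinal.{w}, presentabilityRank.{w} M = Order.succ κ then h.choose
  else presentabilityRank.{w} M

theorem internalSize_eq_of_rank_eq_succ (M : C) (κ : Cardinal.{w})
    (h : presentabilityRank.{w} M = Order.succ κ) : internalSize.{w} M = κ := by
  have h' : ∃ κ : Cardinal.{w}, presentabilityRank.{w} M = Order.succ κ := ⟨κ, h⟩
  rw [internalSize, dif_pos h']
  exact Order.succ_injective (h'.choose_spec.symm.trans h)

theorem internalSize_eq_rank (M : C)
    (h : ∀ κ : Cardinal.{w}, presentabilityRank.{w} M ≠ Order.succ κ) :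
    internalSize.{w} M = presentabilityRank.{w} M := by
  rw [internalSize, dif_neg (by simpa using h)]

end

/-! Fix a small set of `μ`-presentable generators and let the size of an object be its number of
generalized elements, that is, of morphisms from generators. As all morphisms are monomorphisms, a
subobject is determined by its generalized elements. When `κ ^< μ ≤ κ`, a Löwenheim–Skolem argument
shows that any `κ` generalized elements lie in a subobject of size at most `κ`. Hence an object is
the `κ⁺`-directed union of its subobjects of size at most `κ`, so that it is `κ⁺`-presentable if and
only if its size is at most `κ`.

Since the category is large, there is an object of size greater than `λ`. Its subobjects of size at
most `λ` contain a strictly increasing chain of length `λ`, whose union `M` has size exactly `λ` and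
is thus `λ⁺`-presentable. If `λ` is regular, then `M` is not `λ`-presentable, because the identity
of `M` does not factor through the chain. If `λ` is singular and `M` were `κ`-presentable for some
`κ < λ`, then the size of `M` would be at most a successor cardinal less than `λ`. -/

open Limits

theorem mk_Iio_lt_of_toType_ord {c : Cardinal.{w}} (i : c.ord.ToType) : #(Set.Iio i) < c := by
  simpa using mk_Iio_lt i

theorem exists_forall_lt_of_mk_lt_cof {α : Type w} [LinearOrder α] {A : Type w}
    (hA : #A < Order.cof α) (f : A → α) : ∃ i, ∀ a, f a < i := by
  have hf : ¬ IsCofinal (Set.range f) := fun h ↦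
    (mk_range_le.trans_lt hA).not_ge (Order.cof_le h)
  simpa [not_isCofinal_iff] using hf

theorem IsAlmostClosed.powerlt_le {μ lam : Cardinal.{w}} (h : IsAlmostClosed μ lam)
    (hlam : ℵ₀ ≤ lam) (hcof : μ ≤ lam.ord.cof) : lam ^< μ ≤ lam := by
  refine Cardinal.powerlt_le.2 fun ν hν ↦ ?_
  have hbdd (f : ν.out → lam.ord.ToType) : ∃ b, ∀ k, f k < b :=
    exists_forall_lt_of_mk_lt_cof (by simpa using hν.trans_le hcof) f
  choose b hb using hbdd
  have hinj : Function.Injective fun f ↦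
      (⟨b f, fun k ↦ ⟨f k, hb f k⟩⟩ : Σ a : lam.ord.ToType, (ν.out → Set.Iio a)) :=
    Function.LeftInverse.injective (g := fun e k ↦ (e.2 k).1) fun _ ↦ rfl
  calc lam ^ ν = #(ν.out → lam.ord.ToType) := by simp
    _ ≤ Cardinal.sum fun a : lam.ord.ToType ↦ #(ν.out → Set.Iio a) :=
        (mk_le_of_injective hinj).trans_eq (mk_sigma _)
    _ ≤ Cardinal.sum fun _ : lam.ord.ToType ↦ lam := sum_le_sum _ _ fun a ↦ by
        simpa using (le_powerlt _ hν).trans (h _ (mk_Iio_lt_of_toType_ord a))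
    _ = lam := by simp [mul_eq_self hlam]

theorem GCH.schAbove (h : GCH.{w}) {μ : Cardinal.{w}} (hμ : ℵ₀ ≤ μ) : SCHAbove μ μ := by
  refine fun lam hlam _ θ hθ ↦ Cardinal.powerlt_le.2 fun ν hν ↦ ?_
  have hm : max θ ν < lam := max_lt hθ (hν.trans_le hlam)
  rcases lt_or_ge (max θ ν) ℵ₀ with hfin | hinf
  · exact (power_lt_aleph0 ((le_max_left _ _).trans_lt hfin)
      ((le_max_right _ _).trans_lt hfin)).le.trans (hμ.trans hlam)
  · calc θ ^ ν ≤ max θ ν ^ ν := power_le_power_right (le_max_left _ _)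
      _ ≤ max θ ν ^ max θ ν :=
        power_le_power_left (aleph0_pos.trans_le hinf).ne' (le_max_right _ _)
      _ = Order.succ (max θ ν) := by rw [power_self_eq hinf, h _ hinf]
      _ ≤ lam := Order.succ_le_of_lt hm

theorem mk_subtype_hasCardinalLT_le {X : Type w} {μ κ : Cardinal.{w}} (hκ₀ : ℵ₀ ≤ κ) (hμκ : μ ≤ κ)
    (hκ : κ ^< μ ≤ κ) (hX : #X ≤ κ) : #{t : Set X // HasCardinalLT t μ} ≤ κ := by
  have hcover (t : {t : Set X // HasCardinalLT t μ}) :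
      ∃ e : Σ a : μ.ord.ToType, (Set.Iio a → X), Set.range e.2 = t.1 := by
    have ht : #t.1 < μ := (hasCardinalLT_iff_cardinal_mk_lt _ _).1 t.2
    obtain ⟨a, ha⟩ := Ordinal.typein_surj (α := μ.ord.ToType) (· < ·) (o := (#t.1).ord)
      (by simpa using ht)
    have hcard : #(Set.Iio a) = #t.1 :=
      (Ordinal.card_typein (r := ((· < ·) : μ.ord.ToType → _ → Prop)) a).symm.trans (by simp [ha])
    obtain ⟨e⟩ := Cardinal.eq.1 hcard
    exact ⟨⟨a, Subtype.val ∘ e⟩, (e.surjective.range_comp _).trans Subtype.range_coe⟩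
  choose e he using hcover
  have hinj : Function.Injective e := fun s t h ↦ Subtype.ext <| by rw [← he s, ← he t, h]
  calc #{t : Set X // HasCardinalLT t μ}
      ≤ Cardinal.sum fun a : μ.ord.ToType ↦ #(Set.Iio a → X) :=
        (mk_le_of_injective hinj).trans_eq (mk_sigma _)
    _ ≤ Cardinal.sum fun _ : μ.ord.ToType ↦ κ := sum_le_sum _ _ fun a ↦ by
        rw [← power_def]
        exact (power_le_power_right hX).trans
          ((le_powerlt κ (mk_Iio_lt_of_toType_ord a)).trans hκ)
    _ ≤ κ := by simpa using mul_le_of_le hκ₀ hμκ le_rfl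

theorem exists_isCardinalFiltered_superset {J : Type w} [PartialOrder J] {μ κ : Cardinal.{w}}
    [Fact μ.IsRegular] [IsCardinalFiltered J μ] (hμκ : μ ≤ κ) (hκ : κ ^< μ ≤ κ)
    {A : Set J} (hA : #A ≤ κ) : ∃ B : Set J, A ⊆ B ∧ IsCardinalFiltered B μ ∧ #B ≤ κ := by
  have hκ₀ : ℵ₀ ≤ κ := (IsRegular.aleph0_le Fact.out).trans hμκ
  have : Fact (Order.succ κ).IsRegular := ⟨isRegular_succ hκ₀⟩
  simp only [← Order.lt_succ_iff, ← hasCardinalLT_iff_cardinal_mk_lt] at hA ⊢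
  refine SharplyLT.exists_isCardinalFiltered_set_of_exists_cofinal (Order.lt_succ_of_le hμκ)
    (fun X hX ↦ ⟨Set.univ, ?_, .univ⟩) A hA
  simp only [hasCardinalLT_iff_cardinal_mk_lt, Order.lt_succ_iff, mk_univ] at hX ⊢
  exact mk_subtype_hasCardinalLT_le hκ₀ hμκ hκ hX

theorem isCardinalFiltered_toType_ord {μ lam : Cardinal.{w}} [Fact μ.IsRegular]
    (hcof : μ ≤ lam.ord.cof) : IsCardinalFiltered lam.ord.ToType μ :=
  isCardinalFiltered_preorder _ _ fun A f hA ↦ by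
    obtain ⟨i, hi⟩ := exists_forall_lt_of_mk_lt_cof (by simpa using hA.trans_le hcof) f
    exact ⟨i, fun a ↦ (hi a).le⟩

theorem exists_strictMono_toType_ord {α : Type*} [Preorder α] [NoMaxOrder α]
    {lam : Cardinal.{w}} (hα : ∀ (A : Type w) (f : A → α), #A < lam → ∃ x, ∀ a, f a ≤ x) :
    ∃ f : lam.ord.ToType → α, StrictMono f := by
  have hlt (i : lam.ord.ToType) (f : Set.Iio i → α) : ∃ x, ∀ j, f j < x := by
    obtain ⟨x, hx⟩ := hα _ f (mk_Iio_lt_of_toType_ord i)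
    obtain ⟨y, hy⟩ := exists_gt x
    exact ⟨y, fun j ↦ (hx j).trans_lt hy⟩
  choose next hnext using hlt
  let f : lam.ord.ToType → α := wellFounded_lt.fix fun i ih ↦ next i fun j ↦ ih j.1 j.2
  refine ⟨f, fun j i hji ↦ ?_⟩
  have hf : f i = next i fun j ↦ f j.1 := wellFounded_lt.fix_eq _ i
  exact hf ▸ hnext i (fun j ↦ f j.1) ⟨j, hji⟩

theorem mk_le_mk_of_strictMono_set {α X : Type w} [LinearOrder α] [WellFoundedLT α] [NoMaxOrder α]
    {S : α → Set X} (hS : StrictMono S) : #α ≤ #X := by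
  let := SuccOrder.ofLinearWellFoundedLT α
  choose x hx hx' using fun i ↦ Set.exists_of_ssubset (hS (Order.lt_succ i))
  have hlt {i j : α} (hij : i < j) : x i ≠ x j := fun h ↦
    hx' j (h ▸ hS.monotone (Order.succ_le_of_lt hij) (hx i))
  exact mk_le_of_injective fun i j hij ↦
    (lt_trichotomy i j).elim (fun h ↦ (hlt h hij).elim)
      fun h ↦ h.elim id fun h ↦ (hlt h hij.symm).elim

section AccessibleCategories

variable {C : Type u} [Category.{v} C]

theorem hasCardinalLT_arrow_of_mk_le {J : Type w} [Preorder J] {κ : Cardinal.{w}}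
    (hκ : ℵ₀ ≤ κ) (hJ : #J ≤ κ) : HasCardinalLT (Arrow J) (Order.succ κ) := by
  have hprod : #(J × J) ≤ κ := by simpa using mul_le_of_le hκ hJ hJ
  refine HasCardinalLT.of_injective (X := J × J) ?_ (fun f ↦ (f.left, f.right)) ?_
  · rwa [hasCardinalLT_iff_cardinal_mk_lt, Order.lt_succ_iff]
  · rintro ⟨X, Y, f⟩ ⟨X', Y', f'⟩ h
    obtain ⟨rfl, rfl⟩ : X = X' ∧ Y = Y' := by simpa using h
    rw [Subsingleton.elim (α := X ⟶ Y) f f']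

variable (C) in
theorem hasColimitsOfShape_of_isCardinalFiltered (κ : Cardinal.{w}) [Fact κ.IsRegular]
    [HasCardinalFilteredColimits.{w} C κ] (J : Type*) [Category* J]
    [EssentiallySmall.{w} J] [IsCardinalFiltered J κ] : HasColimitsOfShape J C := by
  have := IsCardinalFiltered.of_equivalence κ (equivSmallModel.{w} J)
  have := HasCardinalFilteredColimits.hasColimitsOfShape (κ := κ) C (SmallModel.{w} J)
  exact hasColimitsOfShape_of_equivalence (equivSmallModel.{w} J).symm

theorem colimitsCardinalClosure_colimit (P : ObjectProperty C) {J : Type w} [Preorder J]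
    {F : J ⥤ C} [HasColimit F] {κ : Cardinal.{w}} (hκ : ℵ₀ ≤ κ) (hJ : #J ≤ κ)
    (hF : ∀ j, P (F.obj j)) :
    P.colimitsCardinalClosure (Order.succ κ) (colimit F) :=
  have := P.isClosedUnderColimitsOfShape_colimitsCardinalClosure (Order.succ κ) J
    (hasCardinalLT_arrow_of_mk_le hκ hJ)
  (P.colimitsCardinalClosure (Order.succ κ)).prop_colimit F fun j ↦
    P.le_colimitsCardinalClosure _ _ (hF j)

theorem exists_directed_colimitOfShape {P : ObjectProperty C} {μ : Cardinal.{w}} [Fact μ.IsRegular]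
    (hP : P.IsCardinalFilteredGenerator μ) (X : C) :
    ∃ (J : Type w) (_ : PartialOrder J) (_ : IsCardinalFiltered J μ),
      Nonempty (P.ColimitOfShape J X) := by
  obtain ⟨J, _, _, ⟨p⟩⟩ := hP.exists_colimitsOfShape X
  obtain ⟨α, _, _, F, _⟩ := IsCardinalFiltered.exists_cardinal_directed J μ
  exact ⟨α, inferInstance, inferInstance, ⟨p.reindex F⟩⟩

theorem exists_isIso_ι_of_isCardinalPresentable [∀ (X Y : C) (f : X ⟶ Y), Mono f]
    {J : Type*} [Category* J] [EssentiallySmall.{w} J] {κ : Cardinal.{w}} [Fact κ.IsRegular]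
    [IsCardinalFiltered J κ] {F : J ⥤ C} {c : Cocone F} (hc : IsColimit c)
    [IsCardinalPresentable c.pt κ] :
    ∃ j, IsIso (c.ι.app j) := by
  obtain ⟨j, r, hr⟩ := IsCardinalPresentable.exists_hom_of_isColimit κ hc (𝟙 c.pt)
  exact ⟨j, r, by simp [← cancel_mono (c.ι.app j), hr], hr⟩

variable (C) in
theorem exists_isCardinalFilteredGenerator_ofObj (μ : Cardinal.{w})
    [Fact μ.IsRegular] [HasCardinalFilteredGenerator C μ] :
    ∃ (ι : Type w) (G : ι → C), (ObjectProperty.ofObj G).IsCardinalFilteredGenerator μ := by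
  obtain ⟨P, _, hP⟩ := HasCardinalFilteredGenerator.exists_small_generator C μ
  refine ⟨Shrink (Subtype P), fun i ↦ ((equivShrink _).symm i).1, ?_⟩
  convert hP
  ext X
  simp [ObjectProperty.ofObj_iff, (equivShrink _).symm.exists_congr_left]

theorem internalSize_eq_of_isCardinalPresentable_succ {M : C} {κ : Cardinal.{w}}
    [hκ : Fact (Order.succ κ).IsRegular] (hM : IsCardinalPresentable M (Order.succ κ))
    (hlt : ∀ κ' ≤ κ, ∀ [Fact κ'.IsRegular], ¬ IsCardinalPresentable M κ') :
    internalSize.{w} M = κ :=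
  internalSize_eq_of_rank_eq_succ M κ <| IsLeast.csInf_eq
    ⟨⟨hκ, hM⟩, fun κ' ⟨_, h⟩ ↦ Order.succ_le_of_lt <| not_le.1 fun hκ' ↦ hlt κ' hκ' h⟩

end AccessibleCategories

section GeneralizedElements

variable {C : Type u} [Category.{w} C] {ι : Type w}

/-- The generalized elements of `X` with stages in the family `G`: the morphisms from some `G i`
to `X`. They play the role of the elements of the underlying set of a concrete structure. -/
abbrev GeneralizedElement (G : ι → C) (X : C) : Type w := Σ i, (G i ⟶ X)

namespace GeneralizedElement

variable {G : ι → C} {X Y Z : C}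

/-- The number of generalized elements of `X`. For a family `G` of generators and many cardinals
`κ`, the condition `size G X ≤ κ` is equivalent to `X` being `κ⁺`-presentable, see
`IsLowenheimSkolem.isCardinalPresentable_succ_iff`. -/
noncomputable def size (G : ι → C) (X : C) : Cardinal.{w} := #(GeneralizedElement G X)

/-- The action of a morphism on generalized elements by composition. -/
def postcomp (f : X ⟶ Y) (x : GeneralizedElement G X) : GeneralizedElement G Y := ⟨x.1, x.2 ≫ f⟩

theorem postcomp_comp (f : X ⟶ Y) (g : Y ⟶ Z) (x : GeneralizedElement G X) :
    postcomp (f ≫ g) x = postcomp g (postcomp f x) := by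
  simp [postcomp]

theorem postcomp_surjective (f : X ⟶ Y) [IsSplitEpi f] :
    Function.Surjective (postcomp (G := G) f) :=
  fun y ↦ ⟨postcomp (section_ f) y, by simp [postcomp]⟩

theorem postcomp_injective (f : X ⟶ Y) [Mono f] : Function.Injective (postcomp (G := G) f) := by
  rintro ⟨i, x⟩ ⟨j, y⟩ h
  obtain ⟨rfl, h⟩ := Sigma.mk.inj h
  exact Sigma.ext rfl (heq_of_eq ((cancel_mono f).1 (eq_of_heq h)))

theorem size_le_of_mono (f : X ⟶ Y) [Mono f] : size G X ≤ size G Y :=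
  mk_le_of_injective (postcomp_injective f)

end GeneralizedElement

open GeneralizedElement

section

variable {G : ι → C} {μ : Cardinal.{w}} [Fact μ.IsRegular]
  (hG : (ObjectProperty.ofObj G).IsCardinalFilteredGenerator μ)

include hG

/-- The factorizations through `g` of the legs of a colimit presentation of `X` glue because `g` is
a monomorphism. -/
theorem exists_factor_of_range_postcomp_subset {X Y Z : C} {f : X ⟶ Z} {g : Y ⟶ Z} [Mono g]
    (h : Set.range (postcomp (G := G) f) ⊆ Set.range (postcomp g)) : ∃ k, k ≫ g = f := by
  obtain ⟨J, _, _, ⟨p⟩⟩ := hG.exists_colimitsOfShape X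
  have hgen {A : C} (hA : ObjectProperty.ofObj G A) (a : A ⟶ X) : ∃ k, k ≫ g = a ≫ f := by
    obtain ⟨i⟩ := hA
    obtain ⟨⟨i', k⟩, hk⟩ := h ⟨⟨i, a⟩, rfl⟩
    obtain ⟨rfl, hk⟩ := Sigma.mk.inj hk
    exact ⟨k, eq_of_heq hk⟩
  choose k hk using fun j ↦ hgen (p.prop_diag_obj j) (p.ι.app j)
  let s : Cocone p.diag := Cocone.mk Y
    { app := k
      naturality i j φ := by simp [← cancel_mono g, hk] }
  exact ⟨p.isColimit.desc s, p.isColimit.hom_ext fun j ↦ by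
    rw [p.isColimit.fac_assoc]
    exact hk j⟩

theorem isIso_of_postcomp_surjective {X Y : C} (f : X ⟶ Y) [Mono f]
    (h : Function.Surjective (postcomp (G := G) f)) : IsIso f := by
  obtain ⟨k, hk⟩ := exists_factor_of_range_postcomp_subset hG (f := 𝟙 Y) (g := f)
    (by simp [h.range_eq])
  exact ⟨k, by simp [← cancel_mono f, hk], hk⟩

theorem exists_postcomp_ι_eq {J : Type*} [Category* J] [EssentiallySmall.{w} J]
    [IsCardinalFiltered J μ] {F : J ⥤ C} {c : Cocone F} (hc : IsColimit c)
    (x : GeneralizedElement G c.pt) : ∃ j y, postcomp (c.ι.app j) y = x := by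
  have : IsCardinalPresentable (G x.1) μ := hG.le_isCardinalPresentable _ (.mk x.1)
  obtain ⟨j, y, hy⟩ := IsCardinalPresentable.exists_hom_of_isColimit μ hc x.2
  exact ⟨j, ⟨x.1, y⟩, by simp [postcomp, hy]⟩

theorem size_le_of_isColimit {J : Type w} [SmallCategory J] [IsCardinalFiltered J μ] {F : J ⥤ C}
    {c : Cocone F} (hc : IsColimit c) {κ : Cardinal.{w}} (hκ : ℵ₀ ≤ κ) (hJ : #J ≤ κ)
    (hF : ∀ j, size G (F.obj j) ≤ κ) : size G c.pt ≤ κ := by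
  have hsurj : Function.Surjective
      fun y : Σ j, GeneralizedElement G (F.obj j) ↦ postcomp (c.ι.app y.1) y.2 := fun x ↦
    have ⟨j, y, hy⟩ := exists_postcomp_ι_eq hG hc x
    ⟨⟨j, y⟩, hy⟩
  calc size G c.pt ≤ Cardinal.sum fun j ↦ size G (F.obj j) :=
        (mk_le_of_surjective hsurj).trans_eq (mk_sigma _)
    _ ≤ Cardinal.sum fun _ : J ↦ κ := sum_le_sum _ _ hF
    _ ≤ κ := by simpa using mul_le_of_le hκ hJ le_rfl

theorem nonempty_isColimit_of_forall_exists_postcomp_eq [∀ (X Y : C) (f : X ⟶ Y), Mono f]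
    {J : Type*} [Category* J] {F : J ⥤ C} [HasColimit F] (c : Cocone F)
    (h : ∀ x : GeneralizedElement G c.pt, ∃ j y, postcomp (c.ι.app j) y = x) :
    Nonempty (IsColimit c) := by
  have : IsIso ((colimit.isColimit F).desc c) := isIso_of_postcomp_surjective hG _ fun x ↦ by
    obtain ⟨j, y, rfl⟩ := h x
    exact ⟨postcomp (colimit.ι F j) y, by simp [postcomp]⟩
  exact ⟨(colimit.isColimit F).ofPointIso⟩

theorem strictMono_range_postcomp_ι [∀ (X Y : C) (f : X ⟶ Y), Mono f] {α : Type*} [PartialOrder α]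
    {F : α ⥤ C} (hF : ∀ i j (h : i < j), ¬ IsIso (F.map (homOfLE h.le))) (c : Cocone F) :
    StrictMono fun i ↦ Set.range (postcomp (G := G) (c.ι.app i)) := by
  intro i j hij
  have hw : c.ι.app i = F.map (homOfLE hij.le) ≫ c.ι.app j := (c.w _).symm
  refine ⟨?_, fun h ↦ hF i j hij (isIso_of_postcomp_surjective hG _ fun y ↦ ?_)⟩
  · rintro _ ⟨x, rfl⟩
    exact ⟨postcomp (F.map (homOfLE hij.le)) x, by rw [hw, postcomp_comp]⟩
  · obtain ⟨x, hx⟩ := h ⟨y, rfl⟩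
    exact ⟨x, postcomp_injective (c.ι.app j) (by rw [← hx, hw, postcomp_comp])⟩

end

/-- A cardinal `κ` is a Löwenheim–Skolem cardinal for the family `G` of generators if it satisfies
the cardinal arithmetic which ensures that any `κ` generalized elements of an object lie in a
subobject of size at most `κ`, see `IsLowenheimSkolem.exists_subset_generalizedElements_size_le`. -/
structure IsLowenheimSkolem (G : ι → C) (μ κ : Cardinal.{w}) : Prop where
  le : μ ≤ κ
  powerlt_le : κ ^< μ ≤ κ
  size_le (i : ι) : size G (G i) ≤ κ

/-- The set of generalized elements of `X` which belong to the subobject `S`. -/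
def generalizedElements (G : ι → C) {X : C} (S : Subobject X) : Set (GeneralizedElement G X) :=
  Set.range (postcomp S.arrow)

/-- The tautological cocone with point `X` on the diagram of the subobjects of `X` of size at most
`κ`. -/
noncomputable def subobjectCocone (G : ι → C) (κ : Cardinal.{w}) (X : C) :
    Cocone ((Subtype.mono_coe fun S : Subobject X ↦ size G (S : C) ≤ κ).functor ⋙
      Subobject.underlying) :=
  Cocone.mk X
    { app := fun S ↦ S.1.arrow
      naturality := fun _ _ _ ↦ (Subobject.underlying_arrow _).trans (Category.comp_id _).symm }

theorem mk_generalizedElements (G : ι → C) {X : C} (S : Subobject X) :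
    #(generalizedElements G S) = size G (S : C) :=
  mk_range_eq _ (postcomp_injective _)

section

variable {G : ι → C} {μ κ : Cardinal.{w}} [Fact μ.IsRegular]

theorem generalizedElements_subset_iff (hG : (ObjectProperty.ofObj G).IsCardinalFilteredGenerator μ)
    {X : C} {S T : Subobject X} : generalizedElements G S ⊆ generalizedElements G T ↔ S ≤ T := by
  refine ⟨fun h ↦ ?_, fun h ↦ ?_⟩
  · obtain ⟨k, hk⟩ := exists_factor_of_range_postcomp_subset hG h
    exact Subobject.le_of_comm k hk
  · rintro _ ⟨x, rfl⟩
    exact ⟨postcomp (S.ofLE T h) x, by rw [← postcomp_comp, Subobject.ofLE_arrow]⟩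

theorem essentiallySmall_subobject (hG : (ObjectProperty.ofObj G).IsCardinalFilteredGenerator μ)
    (κ : Cardinal.{w}) (X : C) :
    EssentiallySmall.{w} {S : Subobject X // size G (S : C) ≤ κ} := by
  have hinj : Function.Injective fun S : {S : Subobject X // size G (S : C) ≤ κ} ↦
      generalizedElements G S.1 := fun S T h ↦ Subtype.ext <|
    ((generalizedElements_subset_iff hG).1 h.le).antisymm
      ((generalizedElements_subset_iff hG).1 h.ge)
  have := small_of_injective.{w} hinj
  exact essentiallySmall_of_small_of_locallySmall _

end

namespace IsLowenheimSkolem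

variable {G : ι → C} {μ κ : Cardinal.{w}} [Fact μ.IsRegular]
  (hG : (ObjectProperty.ofObj G).IsCardinalFilteredGenerator μ)

theorem aleph0_le (hκ : IsLowenheimSkolem G μ κ) : ℵ₀ ≤ κ :=
  (IsRegular.aleph0_le Fact.out).trans hκ.le

section

variable [HasCardinalFilteredColimits.{w} C μ] (hκ : IsLowenheimSkolem G μ κ)

include hG hκ

theorem exists_subset_range_postcomp {X : C} {A : Set (GeneralizedElement G X)} (hA : #A ≤ κ) :
    ∃ (Y : C) (m : Y ⟶ X), A ⊆ Set.range (postcomp m) ∧ size G Y ≤ κ ∧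
      (ObjectProperty.ofObj G).colimitsCardinalClosure (Order.succ κ) Y := by
  obtain ⟨J, _, _, ⟨p⟩⟩ := exists_directed_colimitOfShape hG X
  choose stage lift hlift using exists_postcomp_ι_eq hG p.isColimit
  obtain ⟨B, hAB, _, hB⟩ := exists_isCardinalFiltered_superset (μ := μ) hκ.le hκ.powerlt_le
    (mk_image_le (f := stage) (s := A) |>.trans hA)
  have := HasCardinalFilteredColimits.hasColimitsOfShape (κ := μ) C B
  let F : B ⥤ C := (Subtype.mono_coe (· ∈ B)).functor ⋙ p.diag
  let m : colimit F ⟶ X := colimit.desc F (p.cocone.whisker _)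
  refine ⟨colimit F, m, fun x hx ↦ ?_, ?_, ?_⟩
  · let b : B := ⟨stage x, hAB (Set.mem_image_of_mem _ hx)⟩
    let y : GeneralizedElement G (F.obj b) := lift x
    refine ⟨postcomp (colimit.ι F b) y, ?_⟩
    rw [← postcomp_comp, colimit.ι_desc]
    exact hlift x
  · refine size_le_of_isColimit hG (colimit.isColimit F) hκ.aleph0_le hB fun b ↦ ?_
    obtain ⟨i, hi⟩ := (ObjectProperty.ofObj_iff _ _).1 (p.prop_diag_obj b.1)
    exact (congrArg (size G) hi).symm.trans_le (hκ.size_le i)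
  · exact colimitsCardinalClosure_colimit _ hκ.aleph0_le hB fun b ↦ p.prop_diag_obj b.1

end

variable [∀ (X Y : C) (f : X ⟶ Y), Mono f] [HasCardinalFilteredColimits.{w} C μ]

include hG

theorem colimitsCardinalClosure_of_size_le (hκ : IsLowenheimSkolem G μ κ) {X : C}
    (hX : size G X ≤ κ) :
    (ObjectProperty.ofObj G).colimitsCardinalClosure (Order.succ κ) X := by
  obtain ⟨Y, m, hm, -, hY⟩ := hκ.exists_subset_range_postcomp hG (A := .univ) (mk_univ.trans_le hX)
  have : IsIso m := isIso_of_postcomp_surjective hG m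
    (Set.range_eq_univ.1 (Set.univ_subset_iff.1 hm))
  exact ObjectProperty.prop_of_iso _ (asIso m) hY

theorem exists_lt_size (hκ : IsLowenheimSkolem G μ κ) (hC : ¬ EssentiallySmall.{w} C) :
    ∃ X : C, κ < size G X := by
  by_contra! h
  have : Fact (Order.succ κ).IsRegular := ⟨isRegular_succ hκ.aleph0_le⟩
  exact hC (essentiallySmall_iff_objectPropertyEssentiallySmall.2 ⟨inferInstance,
    .of_le (Q := (ObjectProperty.ofObj G).colimitsCardinalClosure (Order.succ κ)) fun X _ ↦
      hκ.colimitsCardinalClosure_of_size_le hG (h X)⟩)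

theorem exists_subset_generalizedElements_size_le (hκ : IsLowenheimSkolem G μ κ) {X : C}
    {A : Set (GeneralizedElement G X)} (hA : #A ≤ κ) :
    ∃ S : Subobject X, A ⊆ generalizedElements G S ∧ size G (S : C) ≤ κ := by
  obtain ⟨Y, m, hm, hY, -⟩ := hκ.exists_subset_range_postcomp hG hA
  refine ⟨Subobject.mk m, hm.trans ?_, (size_le_of_mono (Subobject.underlyingIso m).hom).trans hY⟩
  rintro _ ⟨x, rfl⟩
  exact ⟨postcomp (Subobject.underlyingIso m).inv x, by
    rw [← postcomp_comp, Subobject.underlyingIso_arrow]⟩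

theorem exists_gt_size_le (hκ : IsLowenheimSkolem G μ κ) {X : C} (hX : κ < size G X)
    (S : Subobject X) (hS : size G (S : C) ≤ κ) :
    ∃ T : Subobject X, S < T ∧ size G (T : C) ≤ κ := by
  obtain ⟨x, hx⟩ : ∃ x, x ∉ generalizedElements G S := by
    by_contra! h
    refine hX.not_ge ?_
    rwa [← mk_generalizedElements, Set.eq_univ_of_forall h, mk_univ] at hS
  have hcard : #(insert x (generalizedElements G S) : Set _) ≤ κ :=
    mk_insert_le.trans (add_le_of_le hκ.aleph0_le ((mk_generalizedElements G S).trans_le hS)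
      (one_le_aleph0.trans hκ.aleph0_le))
  obtain ⟨T, hT, hTκ⟩ := hκ.exists_subset_generalizedElements_size_le hG hcard
  rw [Set.insert_subset_iff, generalizedElements_subset_iff hG] at hT
  exact ⟨T, hT.2.lt_of_ne fun h ↦ hx (h ▸ hT.1), hTκ⟩

theorem exists_upperBound_size_le (hκ : IsLowenheimSkolem G μ κ) {X : C} {A : Type w} (hA : #A ≤ κ)
    (S : A → Subobject X) (hS : ∀ a, size G (S a : C) ≤ κ) :
    ∃ T : Subobject X, (∀ a, S a ≤ T) ∧ size G (T : C) ≤ κ := by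
  have hcard : #(⋃ a, generalizedElements G (S a)) ≤ κ :=
    calc #(⋃ a, generalizedElements G (S a))
      _ ≤ Cardinal.sum fun a ↦ #(generalizedElements G (S a)) := mk_iUnion_le_sum_mk
      _ ≤ Cardinal.sum fun _ : A ↦ κ :=
        sum_le_sum _ _ fun a ↦ (mk_generalizedElements G (S a)).trans_le (hS a)
      _ ≤ κ := by simpa using mul_le_of_le hκ.aleph0_le hA le_rfl
  obtain ⟨T, hT, hTκ⟩ := hκ.exists_subset_generalizedElements_size_le hG hcard
  simp only [Set.iUnion_subset_iff, generalizedElements_subset_iff hG] at hT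
  exact ⟨T, hT, hTκ⟩

theorem isCardinalFiltered_subobject (hκ : IsLowenheimSkolem G μ κ) [Fact (Order.succ κ).IsRegular]
    (X : C) : IsCardinalFiltered {S : Subobject X // size G (S : C) ≤ κ} (Order.succ κ) where
  nonempty_cocone {A _} F hA := by
    have hA' : #A ≤ κ := Order.lt_succ_iff.1
      ((hasCardinalLT_iff_cardinal_mk_lt _ _).1 (hasCardinalLT_of_hasCardinalLT_arrow hA))
    obtain ⟨T, hT, hTκ⟩ := hκ.exists_upperBound_size_le hG hA' (fun a ↦ (F.obj a).1)
      fun a ↦ (F.obj a).2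
    exact ⟨Cocone.mk ⟨T, hTκ⟩ { app := fun a ↦ homOfLE (hT a) }⟩

theorem nonempty_isColimit_subobjectCocone (hκ : IsLowenheimSkolem G μ κ) (X : C) :
    Nonempty (IsColimit (subobjectCocone G κ X)) := by
  have : Fact (Order.succ κ).IsRegular := ⟨isRegular_succ hκ.aleph0_le⟩
  have := essentiallySmall_subobject hG κ X
  have := hκ.isCardinalFiltered_subobject hG X
  have := IsCardinalFiltered.of_le {S : Subobject X // size G (S : C) ≤ κ}
    (hκ.le.trans (Order.le_succ κ))
  have := hasColimitsOfShape_of_isCardinalFiltered C μ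
    {S : Subobject X // size G (S : C) ≤ κ}
  refine nonempty_isColimit_of_forall_exists_postcomp_eq hG _ fun x ↦ ?_
  obtain ⟨S, hS, hSκ⟩ := hκ.exists_subset_generalizedElements_size_le hG (A := {x})
    ((mk_singleton x).trans_le (one_le_aleph0.trans hκ.aleph0_le))
  exact ⟨⟨S, hSκ⟩, hS rfl⟩

theorem isCardinalPresentable_succ_iff (hκ : IsLowenheimSkolem G μ κ)
    [Fact (Order.succ κ).IsRegular] {X : C} :
    IsCardinalPresentable X (Order.succ κ) ↔ size G X ≤ κ := by
  refine ⟨fun hX ↦ ?_, fun hX ↦ ?_⟩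
  · obtain ⟨hc⟩ := hκ.nonempty_isColimit_subobjectCocone hG X
    have := essentiallySmall_subobject hG κ X
    have := hκ.isCardinalFiltered_subobject hG X
    have : IsCardinalPresentable (subobjectCocone G κ X).pt (Order.succ κ) := hX
    obtain ⟨S, _⟩ := exists_isIso_ι_of_isCardinalPresentable (κ := Order.succ κ) hc
    exact (size_le_of_mono (inv ((subobjectCocone G κ X).ι.app S))).trans S.2
  · have hμ : isCardinalPresentable.{w} C μ ≤ isCardinalPresentable.{w} C (Order.succ κ) :=
      isCardinalPresentable_monotone C (hκ.le.trans (Order.le_succ κ))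
    exact ObjectProperty.colimitsCardinalClosure_le_isCardinalPresentable.{w} _
      (hG.le_isCardinalPresentable.trans hμ) _ (hκ.colimitsCardinalClosure_of_size_le hG hX)

theorem exists_chain_size_le {lam : Cardinal.{w}} (hlam : IsLowenheimSkolem G μ lam) {N : C}
    (hN : lam < size G N) :
    ∃ F : lam.ord.ToType ⥤ C, (∀ i, size G (F.obj i) ≤ lam) ∧
      ∀ i j (h : i < j), ¬ IsIso (F.map (homOfLE h.le)) := by
  have : NoMaxOrder {S : Subobject N // size G (S : C) ≤ lam} := ⟨fun S ↦ by
    obtain ⟨T, hT, hTlam⟩ := hlam.exists_gt_size_le hG hN S.1 S.2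
    exact ⟨⟨T, hTlam⟩, hT⟩⟩
  obtain ⟨f, hf⟩ := exists_strictMono_toType_ord (lam := lam)
    (α := {S : Subobject N // size G (S : C) ≤ lam}) fun A g hA ↦ by
      obtain ⟨T, hT, hTlam⟩ := hlam.exists_upperBound_size_le hG hA.le (fun a ↦ (g a).1)
        fun a ↦ (g a).2
      exact ⟨⟨T, hTlam⟩, hT⟩
  let F : lam.ord.ToType ⥤ Subobject N :=
    Monotone.functor (f := fun i ↦ (f i).1) fun _ _ h ↦ hf.monotone h
  refine ⟨F ⋙ Subobject.underlying, fun i ↦ (f i).2, fun i j h hiso ↦ (hf h).not_ge ?_⟩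
  have : IsIso ((f i).1.ofLE (f j).1 (hf h).le) := hiso
  exact Subobject.le_of_comm (inv ((f i).1.ofLE (f j).1 (hf h).le)) (by simp)

theorem exists_size_eq_and_not_isCardinalPresentable {lam : Cardinal.{w}}
    (hlam : IsLowenheimSkolem G μ lam) (hcof : μ ≤ lam.ord.cof) {N : C}
    (hN : lam < size G N) :
    ∃ M : C, size G M = lam ∧ ∀ [Fact lam.IsRegular], ¬ IsCardinalPresentable M lam := by
  have := isCardinalFiltered_toType_ord hcof
  have := noMaxOrder hlam.aleph0_le
  have := HasCardinalFilteredColimits.hasColimitsOfShape (κ := μ) C lam.ord.ToType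
  obtain ⟨F, hFsize, hFiso⟩ := hlam.exists_chain_size_le hG hN
  have hmono := strictMono_range_postcomp_ι hG hFiso (colimit.cocone F)
  refine ⟨colimit F, le_antisymm ?_ ?_, fun {_} hM ↦ ?_⟩
  · exact size_le_of_isColimit hG (colimit.isColimit F) hlam.aleph0_le (mk_ord_toType lam).le hFsize
  · exact (mk_ord_toType lam).symm.trans_le (mk_le_mk_of_strictMono_set hmono)
  · have : IsCardinalPresentable (colimit.cocone F).pt lam := hM
    have := isCardinalFiltered_toType_ord (IsRegular.cof_ord (c := lam) Fact.out).ge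
    obtain ⟨i, _⟩ := exists_isIso_ι_of_isCardinalPresentable (κ := lam) (colimit.isColimit F)
    obtain ⟨j, hij⟩ := exists_gt i
    exact (hmono hij).not_ge fun x _ ↦ postcomp_surjective ((colimit.cocone F).ι.app i) x

end IsLowenheimSkolem

theorem SCHAbove.exists_forall_isLowenheimSkolem {μ θ : Cardinal.{w}} (hθ : SCHAbove μ θ)
    (hμ : ℵ₀ ≤ μ) (G : ι → C) :
    ∃ χ, μ ≤ χ ∧ ∀ κ, χ ≤ κ → μ ≤ κ.ord.cof → IsLowenheimSkolem G μ κ := by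
  refine ⟨max (max μ θ) (Cardinal.sum fun i ↦ size G (G i)), by simp, fun κ hκ hcof ↦ ?_⟩
  simp only [max_le_iff] at hκ
  obtain ⟨⟨hμκ, hθκ⟩, hsum⟩ := hκ
  exact ⟨hμκ, (hθ κ hμκ hθκ).powerlt_le (hμ.trans hμκ) hcof, fun i ↦
    (le_sum (fun i ↦ size G (G i)) i).trans hsum⟩

theorem internalSize_eq_of_size_eq [∀ (X Y : C) (f : X ⟶ Y), Mono f] {G : ι → C}
    {μ χ lam : Cardinal.{w}} [Fact μ.IsRegular] [HasCardinalFilteredColimits.{w} C μ]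
    (hG : (ObjectProperty.ofObj G).IsCardinalFilteredGenerator μ) (hμχ : μ ≤ χ)
    (hχ : ∀ κ, χ ≤ κ → μ ≤ κ.ord.cof → IsLowenheimSkolem G μ κ) (hlam : χ < lam)
    (hcof : μ ≤ lam.ord.cof) {M : C} (hM : size G M = lam)
    (hreg : ∀ [Fact lam.IsRegular], ¬ IsCardinalPresentable M lam) :
    internalSize.{w} M = lam := by
  have hLS := hχ lam hlam.le hcof
  have : Fact (Order.succ lam).IsRegular := ⟨isRegular_succ hLS.aleph0_le⟩
  refine internalSize_eq_of_isCardinalPresentable_succ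
    ((hLS.isCardinalPresentable_succ_iff hG).2 hM.le) fun κ hκ hκreg hMκ ↦ ?_
  by_cases hlamreg : lam.IsRegular
  · have : Fact lam.IsRegular := ⟨hlamreg⟩
    exact hreg (isCardinalPresentable_of_le M hκ)
  · have hκlam : κ < lam := hκ.lt_of_ne fun h ↦ hlamreg (h ▸ hκreg.out)
    have hsucc : (Order.succ (max κ χ)).IsRegular :=
      isRegular_succ (hκreg.out.aleph0_le.trans (le_max_left _ _))
    have hsucclam : Order.succ (max κ χ) < lam :=
      (Order.succ_le_of_lt (max_lt hκlam hlam)).lt_of_ne fun h ↦ hlamreg (h ▸ hsucc)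
    have hχsucc : χ ≤ Order.succ (max κ χ) := (le_max_right _ _).trans (Order.le_succ _)
    have hLS' := hχ _ hχsucc ((hμχ.trans hχsucc).trans_eq hsucc.cof_ord.symm)
    have : Fact (Order.succ (Order.succ (max κ χ))).IsRegular :=
      ⟨isRegular_succ hLS'.aleph0_le⟩
    have hκsucc : κ ≤ Order.succ (Order.succ (max κ χ)) :=
      (le_max_left _ _).trans ((Order.le_succ _).trans (Order.le_succ _))
    have hsize := (hLS'.isCardinalPresentable_succ_iff hG).1 (isCardinalPresentable_of_le M hκsucc)
    exact hsucclam.not_ge (hM.symm.trans_le hsize)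

end GeneralizedElements

theorem mainTheorem11 {K : Type u} [Category.{w} K]
    (μ : Cardinal.{w}) [Fact μ.IsRegular]
    [IsCardinalAccessibleCategory.{w} K μ]
    (hlarge : ¬ EssentiallySmall.{w} K)
    (hmono : ∀ {X Y : K} (f : X ⟶ Y), Mono f)
    (hset : GCH.{w} ∨ ∃ θ : Cardinal.{w}, SCHAbove μ θ) :
    ∃ χ : Cardinal.{w}, ∀ lam : Cardinal.{w}, χ ≤ lam → μ ≤ lam.ord.cof →
      ∃ M : K, internalSize.{w} M = lam := by
  have (X Y : K) (f : X ⟶ Y) : Mono f := hmono f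
  have hμ : ℵ₀ ≤ μ := IsRegular.aleph0_le Fact.out
  obtain ⟨θ, hθ⟩ : ∃ θ : Cardinal.{w}, SCHAbove μ θ :=
    hset.elim (fun h ↦ ⟨μ, h.schAbove hμ⟩) id
  obtain ⟨ι, G, hG⟩ := exists_isCardinalFilteredGenerator_ofObj K μ
  obtain ⟨χ, hμχ, hχ⟩ := hθ.exists_forall_isLowenheimSkolem hμ G
  refine ⟨Order.succ χ, fun lam hlam hcof ↦ ?_⟩
  have hχlam : χ < lam := Order.succ_le_iff.1 hlam
  have hLS : IsLowenheimSkolem G μ lam := hχ lam hχlam.le hcof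
  obtain ⟨N, hN⟩ := hLS.exists_lt_size hG hlarge
  obtain ⟨M, hM, hreg⟩ := hLS.exists_size_eq_and_not_isCardinalPresentable hG hcof hN
  exact ⟨M, internalSize_eq_of_size_eq hG hμχ hχ hχlam hcof hM hreg⟩
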